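/- Let $n\ge 0$ and let $\mathscr Z=\{1,-1\}$. For $\ell\in\mathscr Z^n$ let $\mathscr O_\ell=\{x\in\mathbb R^n : \ell_i x_i\ge 0 \text{ for all } i\}$. A set of vector labels *carries a complete set of labels* if it contains $n+1$ different labels $\ell_1,\dots,\ell_{n+1}$ with $\mathscr O_{\ell_1}\cap\dots\cap\mathscr O_{\ell_{n+1}}=\{0\}$. A cube here is a product $\prod_{i=1}^n[a_i,b_i]$ with $a_i<b_i$. A cubical decomposition of a cube $C$ is a finite family of cubes $C_i$ with union $C$, with pairwise disjoint interiors, such that two different members are disjoint or meet in a common face of both. A labeling $\phi:C\to\mathscr Z^n$ is *non-degenerate* if for no proper face $F$ of $C$ the set $\phi(F)$ carries a complete set of labels. A cube $B\subseteq C$ is *completely labeled* if the labels of its vertices carry a complete set of labels. A *special convex polyhedral cone partition* of $\mathbb R^n$ consists of $n+1$ cones $\mathscr N_1,\dots,\mathscr N_{n+1}$, each a finite intersection of half-spaces of the form $\{x_k\ge 0\}$ or $\{x_k\le 0\}$, with $\bigcup_j\mathscr N_j=\mathbb R^n$, pairwise disjoint interiors and $\bigcap_j\mathscr N_j=\{0\}$.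 A *change of labels* is a map $\psi:\mathscr Z^n\to\{1,\dots,n+1\}$ such that, for some such partition, $\mathscr O_\ell\subseteq\mathscr N_{\psi(\ell)}$ for all $\ell$. For a labeling $f$ of the vertices of an oriented $k$-dimensional cube $Q$ by positive integers, the oriented index $\mathrm{ind}_Q(f)\in\mathbb Z$ is defined recursively. If $k=0$, it is $1$ when the label is $1$ and $0$ otherwise. If $k\ge 1$, it is $0$ when the set of labels of the vertices is not $\{1,\dots,k+1\}$, and otherwise it is the sum, over the $(k-1)$-dimensional faces $S$ of $Q$ with the induced orientation, of $\mathrm{ind}_S(f)$; the summand of the face where the $j$-th coordinate of $Q$ is maximal (minimal) is $(-1)^{j-1}$ (respectively $-(-1)^{j-1}$) times the index of that face with its coordinates in increasing order. For a vector labeling $\phi$, the index of $\phi$ on an $n$-dimensional cube $B$ is $\mathrm{ind}_B(\phi)=\mathrm{ind}_B(\psi\circ\phi)$, computed with a change of labels $\psi$. **Statement.** Let $C=\bigcup_i C_i$ be a cube together with a cubical decomposition, and let $\phi:C\to\mathscr Z^n$ be a non-degenerate labeling. Let $\psi$ be any change of labels, and compute all indices with $\psi$. If $\mathrm{ind}_C(\phi)\ne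 0$, then there is a cube $C_i$ such that $\mathrm{ind}_{C_i}(\phi)\ne 0$ and $C_i$ is completely labeled relative to $\phi$. -/

import Mathlib

namespace CubicalSperner

/-- The vector labels `ℓ = (±1, …, ±1)`; `ℤˣ = {1, -1}`. -/
abbrev VLabel (n : ℕ) : Type := Fin n → ℤˣ

/-- The hyperoctant `{x | ∀ i, ℓ i * x i ≥ 0}` of a vector label. -/
def hyperoctant {n : ℕ} (l : VLabel n) : Set (Fin n → ℝ) :=
  {x | ∀ i, 0 ≤ ((l i : ℤ) : ℝ) * x i}

/-- A set `L` of vector labels contains a complete collection: `n + 1` different labels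
whose hyperoctants meet only at the origin. -/
def CarriesComplete {n : ℕ} (L : Set (VLabel n)) : Prop :=
  ∃ l : Fin (n + 1) → VLabel n,
    Function.Injective l ∧ (∀ j, l j ∈ L) ∧ (⋂ j, hyperoctant (l j)) = {0}

/-- The closed cube (with edges parallel to the axes, of arbitrary positive lengths) with
opposite vertices `B.lower` and `B.upper`. Mathlib's own coercion of a box to a set is half-open. -/
def cube {n : ℕ} (B : BoxIntegral.Box (Fin n)) : Set (Fin n → ℝ) :=
  Set.Icc B.lower B.upper

/-- The vertices of the cube: coordinate `i` is the upper bound when `ε i = true`,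
and the lower bound otherwise. -/
def vertex {n : ℕ} (B : BoxIntegral.Box (Fin n)) (ε : Fin n → Bool) : Fin n → ℝ :=
  fun i => if ε i then B.upper i else B.lower i

/-- The nonempty faces of the cube: coordinate `i` is fixed at its upper bound when
`σ i = some true`, fixed at its lower bound when `σ i = some false`, and free when `σ i = none`. -/
def face {n : ℕ} (B : BoxIntegral.Box (Fin n)) (σ : Fin n → Option Bool) : Set (Fin n → ℝ) :=
  {x | x ∈ cube B ∧ ∀ i b, σ i = some b → x i = if b then B.upper i else B.lower i}

/-- A finite family of cubes `D` subdivides `C`: the union is `C`, the interiors are pairwise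
disjoint, and two different members are disjoint or meet in a common face. -/
structure IsCubicalDecomposition {n : ℕ} {ι : Type*} (C : BoxIntegral.Box (Fin n))
    (D : ι → BoxIntegral.Box (Fin n)) : Prop where
  finite : Finite ι
  iUnion_eq : (⋃ i, cube (D i)) = cube C
  interior_disjoint : ∀ i j, i ≠ j → interior (cube (D i)) ∩ interior (cube (D j)) = ∅
  inter_face : ∀ i j, i ≠ j → cube (D i) ∩ cube (D j) = ∅ ∨
    ((∃ σ, cube (D i) ∩ cube (D j) = face (D i) σ) ∧
      ∃ σ, cube (D i) ∩ cube (D j) = face (D j) σ)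

/-- No proper face of `C` carries a complete set of labels. -/
def IsNonDegenerate {n : ℕ} (C : BoxIntegral.Box (Fin n)) (φ : (Fin n → ℝ) → VLabel n) : Prop :=
  ∀ σ : Fin n → Option Bool, (∃ i, σ i ≠ none) → ¬ CarriesComplete (φ '' face C σ)

/-- The vertices of the cube carry a complete set of labels. -/
def IsCompletelyLabeled {n : ℕ} (B : BoxIntegral.Box (Fin n)) (φ : (Fin n → ℝ) → VLabel n) :
    Prop :=
  CarriesComplete (Set.range fun ε => φ (vertex B ε))

/-- A convex polyhedral cone bounded by coordinate hyperplanes: a (finite) intersection of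
half-spaces of the form `x k ≥ 0` or `x k ≤ 0`. -/
def IsCoordinateCone {n : ℕ} (N : Set (Fin n → ℝ)) : Prop :=
  ∃ H : Set (Fin n × ℤˣ), N = {x | ∀ p ∈ H, 0 ≤ ((p.2 : ℤ) : ℝ) * x p.1}

/-- A special convex polyhedral cone partition of `ℝⁿ`. -/
structure IsSpecialConePartition {n : ℕ} (N : Fin (n + 1) → Set (Fin n → ℝ)) : Prop where
  cone : ∀ j, IsCoordinateCone (N j)
  iUnion_eq : (⋃ j, N j) = Set.univ
  interior_disjoint : ∀ j k, j ≠ k → interior (N j) ∩ interior (N k) = ∅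
  iInter_eq : (⋂ j, N j) = {0}

/-- A change of labels from vector labels to the `n + 1` labels of `Fin (n + 1)`: it sends `ℓ` to
the index of the member, of some special convex polyhedral cone partition, that contains the
hyperoctant of `ℓ`. -/
def IsChangeOfLabels {n : ℕ} (ψ : VLabel n → Fin (n + 1)) : Prop :=
  ∃ N : Fin (n + 1) → Set (Fin n → ℝ),
    IsSpecialConePartition N ∧ ∀ l, hyperoctant l ⊆ N (ψ l)

/-- The oriented index of a labeling `f` of the vertices of the `k`-dimensional cube, the labels
`1, 2, 3, …` being numbered `0, 1, 2, …`. In dimension `0` it is `1` for the first label and `0`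
otherwise. In dimension `k + 1` it is `0` unless exactly the first `k + 2` labels occur, and then
it is the sum of the indices of the facets with the orientations induced by the standard one:
the facet on which coordinate `j` is maximal (minimal), with its remaining coordinates in
increasing order, has sign `(-1) ^ j` (respectively `-(-1) ^ j`). In dimension `1` this is
`1` or `-1` when both labels occur, according to the orientation. -/
def cubeIndex : (k : ℕ) → ((Fin k → Bool) → ℕ) → ℤ
  | 0, f => if f (fun i => i.elim0) = 0 then 1 else 0
  | k + 1, f =>
    if Finset.univ.image f = Finset.range (k + 2) then
      ∑ j : Fin (k + 1), (-1) ^ (j : ℕ) *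
        (cubeIndex k (fun ε => f (Fin.insertNth j true ε)) -
          cubeIndex k (fun ε => f (Fin.insertNth j false ε)))
    else 0

/-- The index on the cube `B` of the vector labeling `φ`, computed with the change of
labels `ψ`: the oriented index of `ψ ∘ φ`. -/
def labelIndex {n : ℕ} (ψ : VLabel n → Fin (n + 1)) (φ : (Fin n → ℝ) → VLabel n)
    (B : BoxIntegral.Box (Fin n)) : ℤ :=
  cubeIndex n (fun ε => (ψ (φ (vertex B ε)) : ℕ))

end CubicalSperner

/-! The index is additive: the cells' indices sum to that of `C` (`sum_labelIndex_eq`). So a nonzero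
index on `C` forces one on some cell, where all `n + 1` labels must occur, and a change of labels
turns these into a complete set.

Additivity is a homotopy argument. Over each cell put a prism of dimension `n + 1`, labeled below by
`ψ ∘ φ` and above by the same labeling after rounding to vertices of `C`. Label number `n` is the
largest available, so every prism has index zero, while `cubeIndex_succ_eq_facetSum` makes that
index an alternating facet sum. Hence top minus bottom is a sum over lateral facets. Inner lateral
facets cancel between neighbouring cells; those over the boundary of `C` miss a label by
non-degeneracy. On top, rounding collapses every cell but one, and that one carries the labels of
`C`. -/

namespace CubicalSperner

/-! ### The index as a boundary sum. -/

/-- The alternating sum of the indices of the facets of a labeled cube. -/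
def facetSum (k : ℕ) (f : (Fin (k + 1) → Bool) → ℕ) : ℤ :=
  ∑ j : Fin (k + 1), (-1) ^ (j : ℕ) *
    (cubeIndex k (fun ε => f (Fin.insertNth j true ε)) -
      cubeIndex k (fun ε => f (Fin.insertNth j false ε)))

theorem insertNth_insertNth_swap {k : ℕ} {α : Type*} (i : Fin (k + 2)) (l : Fin (k + 1))
    (a b : α) (ε : Fin k → α) :
    (Fin.insertNth i a (Fin.insertNth l b ε : Fin (k + 1) → α) : Fin (k + 2) → α) =
      Fin.insertNth (i.succAbove l) b
        (Fin.insertNth (l.predAbove i) a ε : Fin (k + 1) → α) := by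
  symm
  rw [Fin.insertNth_eq_iff]
  refine ⟨by simp, ?_⟩
  rw [Fin.insertNth_eq_iff]
  refine ⟨?_, ?_⟩
  · simp only [Fin.removeNth_apply]
    rw [Fin.succAbove_succAbove_predAbove, Fin.insertNth_apply_same]
  · rw [← Fin.removeNth_removeNth_eq_swap]
    simp

theorem cubeIndex_eq_zero_of_forall_ne {k : ℕ} (f : (Fin k → Bool) → ℕ) {m : ℕ} (hm : m ≤ k)
    (h : ∀ ε, f ε ≠ m) : cubeIndex k f = 0 := by
  cases k with
  | zero =>
    obtain rfl : m = 0 := by omega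
    simp [cubeIndex, h]
  | succ k =>
    rw [cubeIndex, if_neg]
    intro h'
    have : m ∈ Finset.univ.image f := by rw [h']; simp; omega
    obtain ⟨ε, -, hε⟩ := Finset.mem_image.1 this
    exact h ε hε

/-- The alternating sum over pairs of nested facets vanishes. -/
theorem sum_sum_facets_eq_zero {k : ℕ} (F : ((Fin k → Bool) → ℕ) → ℤ)
    (f : (Fin (k + 2) → Bool) → ℕ) :
    ∑ i : Fin (k + 2), (-1 : ℤ) ^ (i : ℕ) *
      ((∑ l : Fin (k + 1), (-1 : ℤ) ^ (l : ℕ) *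
        (F (fun ε => f (Fin.insertNth i true (Fin.insertNth l true ε : Fin (k + 1) → Bool))) -
          F (fun ε => f (Fin.insertNth i true (Fin.insertNth l false ε : Fin (k + 1) → Bool))))) -
      ∑ l : Fin (k + 1), (-1 : ℤ) ^ (l : ℕ) *
        (F (fun ε => f (Fin.insertNth i false (Fin.insertNth l true ε : Fin (k + 1) → Bool))) -
          F (fun ε => f (Fin.insertNth i false (Fin.insertNth l false ε : Fin (k + 1) → Bool)))))
      = 0 := by
  simp only [← Finset.sum_sub_distrib, Finset.mul_sum]
  rw [← Finset.sum_product']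
  -- Each face of codimension two lies in two facets; the involution exchanges the order in which
  -- its two directions are fixed, which reverses the sign.
  refine Finset.sum_involution (fun p _ => (p.1.succAbove p.2, p.2.predAbove p.1)) ?_ ?_ ?_ ?_
  · rintro ⟨i, l⟩ -
    have hs := Fin.neg_one_pow_succAbove_add_predAbove (R := ℤ) i l
    simp only [insertNth_insertNth_swap i l]
    rw [pow_add, pow_add] at hs
    simp only [← mul_sub, ← mul_assoc]
    linear_combination
      (F (fun ε => f (Fin.insertNth (i.succAbove l) true
            (Fin.insertNth (l.predAbove i) true ε : Fin (k + 1) → Bool))) -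
          F (fun ε => f (Fin.insertNth (i.succAbove l) false
            (Fin.insertNth (l.predAbove i) true ε : Fin (k + 1) → Bool))) -
        (F (fun ε => f (Fin.insertNth (i.succAbove l) true
            (Fin.insertNth (l.predAbove i) false ε : Fin (k + 1) → Bool))) -
          F (fun ε => f (Fin.insertNth (i.succAbove l) false
            (Fin.insertNth (l.predAbove i) false ε : Fin (k + 1) → Bool))))) * hs
  · rintro ⟨i, l⟩ - - h
    exact Fin.succAbove_ne i l (congrArg Prod.fst h)
  · simp
  · rintro ⟨i, l⟩ -
    simp [Fin.succAbove_succAbove_predAbove, Fin.predAbove_predAbove_succAbove]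

/-- If all labels are at most the dimension, the index is the sum of the indices of the facets,
whichever labels occur. -/
theorem cubeIndex_succ_eq_facetSum {k : ℕ} (f : (Fin (k + 1) → Bool) → ℕ)
    (hf : ∀ ε, f ε ≤ k + 1) : cubeIndex (k + 1) f = facetSum k f := by
  induction k with
  | zero =>
    by_cases h : Finset.univ.image f = Finset.range (0 + 2)
    · rw [cubeIndex, if_pos h]; rfl
    by_cases h0 : ∃ m ≤ 0, ∀ ε, f ε ≠ m
    · obtain ⟨m, hm, h0⟩ := h0
      rw [cubeIndex_eq_zero_of_forall_ne f (by omega) h0, facetSum]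
      simp [cubeIndex_eq_zero_of_forall_ne _ hm (fun ε => h0 _)]
    · by_cases h1 : ∀ ε, f ε ≠ 1
      · have : ∀ ε, f ε = 0 := fun ε => by have := hf ε; have := h1 ε; omega
        rw [cubeIndex_eq_zero_of_forall_ne f (by omega) h1, facetSum]
        simp [this]
      · exfalso
        apply h
        push Not at h0 h1
        obtain ⟨a, ha⟩ := h0 0 le_rfl
        obtain ⟨b, hb⟩ := h1
        ext m
        simp only [Finset.mem_image, Finset.mem_univ, true_and, Finset.mem_range]
        constructor
        · rintro ⟨ε, rfl⟩
          have := hf ε; omega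
        · intro hm
          interval_cases m
          exacts [⟨a, ha⟩, ⟨b, hb⟩]
  | succ k ih =>
    by_cases h : Finset.univ.image f = Finset.range (k + 1 + 2)
    · rw [cubeIndex, if_pos h]; rfl
    by_cases h0 : ∃ m ≤ k + 1, ∀ ε, f ε ≠ m
    · obtain ⟨m, hm, h0⟩ := h0
      rw [cubeIndex_eq_zero_of_forall_ne f (by omega) h0, facetSum]
      simp [cubeIndex_eq_zero_of_forall_ne _ hm (fun ε => h0 _)]
    · by_cases h1 : ∀ ε, f ε ≠ k + 2
      -- Only the top label is missing, so every facet satisfies the induction hypothesis and the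
      -- double boundary vanishes.
      · have hle : ∀ ε, f ε ≤ k + 1 := fun ε => by have := hf ε; have := h1 ε; omega
        rw [cubeIndex_eq_zero_of_forall_ne f (by omega) h1, facetSum]
        simp only [fun (j : Fin (k + 2)) (b : Bool) =>
          ih (fun ε => f (Fin.insertNth j b ε)) (fun ε => hle _), facetSum]
        exact (sum_sum_facets_eq_zero (cubeIndex k) f).symm
      · exfalso
        apply h
        push Not at h0 h1
        ext m
        simp only [Finset.mem_image, Finset.mem_univ, true_and, Finset.mem_range]
        constructor
        · rintro ⟨ε, rfl⟩
          have := hf ε; omega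
        · intro hm
          rcases Nat.lt_or_ge m (k + 2) with hm' | hm'
          · exact h0 m (by omega)
          · obtain rfl : m = k + 2 := by omega
            exact h1

/-- The two facets orthogonal to `j` have equal labels and cancel; all others are again constant in
direction `j`. -/
theorem cubeIndex_eq_zero_of_const {k : ℕ} (f : (Fin k → Bool) → ℕ) (j : Fin k)
    (h : ∀ ε b, f (Function.update ε j b) = f ε) : cubeIndex k f = 0 := by
  induction k with
  | zero => exact j.elim0
  | succ k ih =>
    rw [cubeIndex]
    split_ifs
    · refine Finset.sum_eq_zero fun i _ => ?_
      rcases eq_or_ne i j with rfl | hij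
      · have : ∀ ε, f (Fin.insertNth i true ε) = f (Fin.insertNth i false ε) := fun ε => by
          rw [← h (Fin.insertNth i false ε) true, Fin.update_insertNth]
        simp [this]
      · obtain ⟨l, rfl⟩ := Fin.exists_succAbove_eq hij.symm
        have : ∀ b, cubeIndex k (fun ε => f (Fin.insertNth i b ε)) = 0 := fun b =>
          ih _ l fun ε c => by rw [Fin.insertNth_update, h]
        simp [this]
    · rfl

/-! ### Neighbouring cells of a cubical decomposition. -/

open BoxIntegral Filter Topology

variable {n : ℕ} {ι : Type*} {C : Box (Fin n)} {D : ι → Box (Fin n)}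

/-- The upper bound (`b = true`) or lower bound (`b = false`) of a box in direction `j`. -/
def bound (B : Box (Fin n)) (b : Bool) (j : Fin n) : ℝ := if b then B.upper j else B.lower j

theorem bound_mem_Icc (B : Box (Fin n)) (b : Bool) (j : Fin n) :
    bound B b j ∈ Set.Icc (B.lower j) (B.upper j) := by
  have := B.lower_lt_upper j
  cases b <;> simp [bound, this.le]

theorem mem_cube_iff {B : Box (Fin n)} {x : Fin n → ℝ} :
    x ∈ cube B ↔ ∀ k, x k ∈ Set.Icc (B.lower k) (B.upper k) := by
  simp [cube, Pi.le_def, forall_and]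

theorem vertex_mem_cube (B : Box (Fin n)) (ε : Fin n → Bool) : vertex B ε ∈ cube B :=
  mem_cube_iff.2 fun k => bound_mem_Icc B (ε k) k

namespace IsCubicalDecomposition

theorem cube_subset (hD : IsCubicalDecomposition C D) (i : ι) : cube (D i) ⊆ cube C :=
  hD.iUnion_eq ▸ Set.subset_iUnion (fun i => cube (D i)) i

theorem lower_le_lower (hD : IsCubicalDecomposition C D) (i : ι) (k : Fin n) :
    C.lower k ≤ (D i).lower k :=
  (mem_cube_iff.1 (hD.cube_subset i (vertex_mem_cube (D i) fun _ => false)) k).1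

theorem upper_le_upper (hD : IsCubicalDecomposition C D) (i : ι) (k : Fin n) :
    (D i).upper k ≤ C.upper k :=
  (mem_cube_iff.1 (hD.cube_subset i (vertex_mem_cube (D i) fun _ => true)) k).2

theorem exists_mem_cube (hD : IsCubicalDecomposition C D) {x : Fin n → ℝ} (hx : x ∈ cube C) :
    ∃ i, x ∈ cube (D i) := by
  rwa [← hD.iUnion_eq, Set.mem_iUnion] at hx

/-- Two cells that overlap in every direction are equal. -/
theorem eq_of_overlap (hD : IsCubicalDecomposition C D) {i i' : ι}
    (h₁ : ∀ k, (D i).lower k < (D i').upper k) (h₂ : ∀ k, (D i').lower k < (D i).upper k) :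
    i = i' := by
  by_contra hne
  have hmid : ∀ k, ∃ y, max ((D i).lower k) ((D i').lower k) < y ∧
      y < min ((D i).upper k) ((D i').upper k) := fun k =>
    exists_between (max_lt (lt_min ((D i).lower_lt_upper k) (h₁ k))
      (lt_min (h₂ k) ((D i').lower_lt_upper k)))
  choose x hx using hmid
  have hint : ∀ B : Box (Fin n), (∀ k, B.lower k < x k ∧ x k < B.upper k) →
      x ∈ interior (cube B) := fun B hB => by
    rw [cube, ← Set.pi_univ_Icc, interior_pi_set Set.finite_univ]
    simpa [interior_Icc] using hB
  have : x ∈ interior (cube (D i)) ∩ interior (cube (D i')) :=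
    ⟨hint _ fun k => ⟨(le_max_left _ _).trans_lt (hx k).1, (hx k).2.trans_le (min_le_left _ _)⟩,
      hint _ fun k => ⟨(le_max_right _ _).trans_lt (hx k).1, (hx k).2.trans_le (min_le_right _ _)⟩⟩
  rw [hD.interior_disjoint i i' hne] at this
  exact this

end IsCubicalDecomposition

/-- `B'` lies on the other side of the `b`-facet of `B` in direction `j`, and shares it. -/
structure IsNeighbour (B B' : Box (Fin n)) (j : Fin n) (b : Bool) : Prop where
  bound_eq : bound B' (!b) j = bound B b j
  lower_eq : ∀ k, k ≠ j → B'.lower k = B.lower k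
  upper_eq : ∀ k, k ≠ j → B'.upper k = B.upper k

theorem IsNeighbour.symm {B B' : Box (Fin n)} {j : Fin n} {b : Bool} (h : IsNeighbour B B' j b) :
    IsNeighbour B' B j (!b) :=
  ⟨by simpa using h.bound_eq.symm, fun k hk => (h.lower_eq k hk).symm,
    fun k hk => (h.upper_eq k hk).symm⟩

theorem IsNeighbour.vertex_eq {B B' : Box (Fin n)} {j : Fin n} {b : Bool}
    (h : IsNeighbour B B' j b) {δ δ' : Fin n → Bool} (hδ : δ j = b) (hδ' : δ' j = !b)
    (hk : ∀ k, k ≠ j → δ k = δ' k) : vertex B δ = vertex B' δ' := by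
  ext k
  rcases eq_or_ne k j with rfl | hkj
  · simpa [vertex, bound, hδ, hδ'] using h.bound_eq.symm
  · simp [vertex, h.lower_eq k hkj, h.upper_eq k hkj, hk k hkj]

namespace IsCubicalDecomposition

theorem isNeighbour_unique (hD : IsCubicalDecomposition C D) {B : Box (Fin n)} {i i' : ι}
    {j : Fin n} {b : Bool} (h : IsNeighbour B (D i) j b) (h' : IsNeighbour B (D i') j b) :
    i = i' := by
  have hb : bound (D i) (!b) j = bound (D i') (!b) j := h.bound_eq.trans h'.bound_eq.symm
  have hi := (D i).lower_lt_upper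
  have hi' := (D i').lower_lt_upper
  apply hD.eq_of_overlap
  all_goals
    intro k
    rcases eq_or_ne k j with rfl | hkj
    · have := hi k
      have := hi' k
      cases b <;> simp [bound] at hb <;> linarith
    · have := hi k
      have := hi' k
      have := h.lower_eq k hkj
      have := h'.lower_eq k hkj
      have := h.upper_eq k hkj
      have := h'.upper_eq k hkj
      linarith

/-- Some other cell contains the centre of an interior facet and reaches beyond it. -/
theorem exists_beyond (hD : IsCubicalDecomposition C D) (i : ι) (j : Fin n) (b : Bool)
    (hb : bound (D i) b j ≠ bound C b j) (p : Fin n → ℝ) (hp : p ∈ cube (D i))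
    (hpj : p j = bound (D i) b j) :
    ∃ i', i ≠ i' ∧ p ∈ cube (D i') ∧ bound (D i') b j ≠ bound (D i) b j := by
  have := hD.finite
  have hC := mem_cube_iff.1 (hD.cube_subset i hp)
  set q : ℝ → Fin n → ℝ := fun t => Function.update p j (p j + t * (bound C b j - p j)) with hq
  have hqc : Continuous q := by fun_prop
  have hq0 : q 0 = p := by simp [hq]
  have hmem : ∀ᶠ t in 𝓝[>] (0 : ℝ), ∃ i', q t ∈ cube (D i') := by
    filter_upwards [Ioo_mem_nhdsGT (zero_lt_one (α := ℝ))] with t ht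
    apply hD.exists_mem_cube
    rw [mem_cube_iff]
    intro k
    rcases eq_or_ne k j with rfl | hkj
    · have h₁ := hC k
      have h₂ := bound_mem_Icc C b k
      have h := convex_Icc (C.lower k) (C.upper k) h₁ h₂ (a := 1 - t) (b := t)
        (by linarith [ht.2]) ht.1.le (by ring)
      simp only [smul_eq_mul] at h
      simp only [hq, Function.update_self]
      convert h using 1
      ring
    · simpa [hq, hkj] using hC k
  -- There are finitely many cells, so one of them contains points `q t` with arbitrarily small `t >
  -- 0`; being closed, it also contains `p`.
  obtain ⟨i', hi'⟩ := frequently_exists.1 hmem.frequently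
  have hpi' : p ∈ cube (D i') := by
    have hcl : IsClosed {t | q t ∈ cube (D i')} := isClosed_Icc.preimage hqc
    have := hcl.mem_of_frequently_of_tendsto hi' (tendsto_id.mono_left nhdsWithin_le_nhds)
    simpa [hq0] using this
  obtain ⟨t, hti', ht⟩ := (hi'.and_eventually self_mem_nhdsWithin).exists
  have ht : 0 < t := ht
  have hqj : q t j = bound (D i) b j + t * (bound C b j - bound (D i) b j) := by simp [hq, hpj]
  have hti'j := mem_cube_iff.1 hti' j
  rw [hqj] at hti'j
  have hne : bound (D i') b j ≠ bound (D i) b j := by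
    intro he
    have hl := hD.lower_le_lower i j
    have hu := hD.upper_le_upper i j
    cases b
    · simp only [bound, Bool.false_eq_true, if_false] at he hti'j hb
      have := mul_pos ht (sub_pos.2 (lt_of_le_of_ne hl (Ne.symm hb)))
      linarith [hti'j.1]
    · simp only [bound, if_true] at he hti'j hb
      have := mul_pos ht (sub_pos.2 (lt_of_le_of_ne hu hb))
      linarith [hti'j.2]
  exact ⟨i', fun h => hne (h ▸ rfl), hpi', hne⟩

/-- The common face with the cell beyond contains the centre of the facet, so it is fixed in no
direction other than `j`; disjoint interiors then make it the whole facet, for both cells. -/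
theorem exists_isNeighbour (hD : IsCubicalDecomposition C D) (i : ι) (j : Fin n) (b : Bool)
    (hb : bound (D i) b j ≠ bound C b j) : ∃ i', IsNeighbour (D i) (D i') j b := by
  set p : Fin n → ℝ :=
    Function.update (fun k => ((D i).lower k + (D i).upper k) / 2) j (bound (D i) b j) with hp
  have hpD : p ∈ cube (D i) := by
    rw [mem_cube_iff]
    intro k
    rcases eq_or_ne k j with rfl | hkj
    · simpa [hp] using bound_mem_Icc (D i) b k
    · have := (D i).lower_lt_upper k
      simp only [hp, Function.update_of_ne hkj]
      constructor <;> linarith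
  obtain ⟨i', hne, hpi', hbd⟩ := hD.exists_beyond i j b hb p hpD (by simp [hp])
  refine ⟨i', ?_⟩
  have hpp : p ∈ cube (D i) ∩ cube (D i') := ⟨hpD, hpi'⟩
  rcases hD.inter_face i i' hne with h0 | ⟨⟨σ, hσ⟩, σ', hσ'⟩
  · rw [h0] at hpp
    exact hpp.elim
  have hσk : ∀ k, k ≠ j → σ k = none := by
    intro k hkj
    have hpσ := (hσ ▸ hpp : p ∈ face (D i) σ).2 k
    have := (D i).lower_lt_upper k
    simp only [hp, Function.update_of_ne hkj] at hpσ
    rcases h : σ k with _ | b'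
    · rfl
    · have := hpσ b' h
      cases b' <;> simp at this <;> linarith
  have hσj : σ j = some b := by
    have hpσ := (hσ ▸ hpp : p ∈ face (D i) σ).2 j
    rcases h : σ j with _ | b'
    -- If `j` were free too, `D i` would lie inside `D i'`, and the two cells would overlap in every
    -- direction.
    · exfalso
      have hsub : ∀ ε, vertex (D i) ε ∈ cube (D i') := fun ε => by
        have : vertex (D i) ε ∈ face (D i) σ := by
          refine ⟨vertex_mem_cube _ _, fun k b' hk => ?_⟩
          rcases eq_or_ne k j with rfl | hkj
          · simp [h] at hk
          · simp [hσk k hkj] at hk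
        exact (hσ ▸ this : _ ∈ cube (D i) ∩ cube (D i')).2
      apply hne
      have h₀ := fun k => mem_cube_iff.1 (hsub fun _ => false) k
      have h₁ := fun k => mem_cube_iff.1 (hsub fun _ => true) k
      simp only [vertex] at h₀ h₁
      apply hD.eq_of_overlap
      · exact fun k => ((D i).lower_lt_upper k).trans_le (h₁ k).2
      · exact fun k => (h₀ k).1.trans_lt ((D i).lower_lt_upper k)
    · have := hpσ b' h
      have hlt := (D i).lower_lt_upper j
      simp only [hp, Function.update_self, bound] at this
      cases b <;> cases b' <;> simp at this ⊢ <;> linarith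
  -- the facet of `D i` is the intersection
  have hfacet : ∀ ε, ε j = b → vertex (D i) ε ∈ face (D i') σ' := fun ε hε => by
    rw [← hσ', hσ]
    refine ⟨vertex_mem_cube _ _, fun k b' hk => ?_⟩
    rcases eq_or_ne k j with rfl | hkj
    · obtain rfl : b = b' := by simpa [hσj] using hk
      simp [vertex, hε]
    · simp [hσk k hkj] at hk
  have hσ'k : ∀ k, k ≠ j → σ' k = none := by
    intro k hkj
    rcases h : σ' k with _ | b'
    · rfl
    -- A fixed direction `k ≠ j` would give opposite vertices of the facet the same `k`-th
    -- coordinate.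
    · exfalso
      have h₀ := (hfacet (Function.update (fun _ => false) j b) (by simp)).2 k b' h
      have h₁ := (hfacet (Function.update (fun _ => true) j b) (by simp)).2 k b' h
      simp only [vertex, Function.update_of_ne hkj] at h₀ h₁
      have := (D i).lower_lt_upper k
      simp at h₀ h₁
      linarith
  have hpj : p j = bound (D i) b j := by simp [hp]
  have hback : ∀ ε, (∀ b', σ' j = some b' → ε j = b') → vertex (D i') ε ∈ face (D i) σ :=
      fun ε hε => by
    rw [← hσ, hσ']
    refine ⟨vertex_mem_cube _ _, fun k b' hk => ?_⟩
    rcases eq_or_ne k j with rfl | hkj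
    · simp [vertex, hε b' hk]
    · simp [hσ'k k hkj] at hk
  -- Otherwise the shared face contains a vertex of `D i'` at its `b`-bound, so the `b`-bounds of
  -- both cells agree, contrary to `hbd`.
  have hσ'j : σ' j = some (!b) := by
    rcases h : σ' j with _ | b'
    · exfalso
      have := (hback (fun _ => b) (by simp [h])).2 j b hσj
      exact hbd this
    · by_cases hb' : b' = b
      · subst hb'
        exact (hbd ((hback (fun _ => b') (by simp [h])).2 j b' hσj)).elim
      · rw [Bool.eq_not.2 hb']
  refine ⟨(hback (fun _ => !b) (by simp [hσ'j])).2 j b hσj, fun k hkj => ?_, fun k hkj => ?_⟩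
  · have h₁ := mem_cube_iff.1 (hback (Function.update (fun _ => false) j (!b))
      (by simp [hσ'j])).1 k
    have h₂ := mem_cube_iff.1 (hfacet (Function.update (fun _ => false) j b) (by simp)).1 k
    simp [vertex, hkj] at h₁ h₂
    exact le_antisymm h₂.1 h₁.1
  · have h₁ := mem_cube_iff.1 (hback (Function.update (fun _ => true) j (!b))
      (by simp [hσ'j])).1 k
    have h₂ := mem_cube_iff.1 (hfacet (Function.update (fun _ => true) j b) (by simp)).1 k
    simp [vertex, hkj] at h₁ h₂
    exact le_antisymm h₁.2 h₂.2

end IsCubicalDecomposition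
-- Prisms and cancellation of lateral facets.
/-- The labeling of the prism over `B` (direction `0` being the new one) given by the labelings
`G false` on the bottom and `G true` on the top. -/
def prismLabel (G : Bool → (Fin n → ℝ) → ℕ) (B : Box (Fin n)) (δ : Fin (n + 1) → Bool) : ℕ :=
  G (δ 0) (vertex B (Fin.tail δ))

/-- The index of a lateral facet of the prism over `B`. -/
def sideIndex (G : Bool → (Fin n → ℝ) → ℕ) (B : Box (Fin n)) (j : Fin n) (b : Bool) : ℤ :=
  cubeIndex n (fun ε => prismLabel G B (Fin.insertNth j.succ b ε))

theorem cubeIndex_top_sub_bottom (G : Bool → (Fin n → ℝ) → ℕ) (hG : ∀ b x, G b x ≤ n)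
    (B : Box (Fin n)) :
    cubeIndex n (fun ε => G true (vertex B ε)) - cubeIndex n (fun ε => G false (vertex B ε)) =
      ∑ j : Fin n, (-1) ^ (j : ℕ) * (sideIndex G B j true - sideIndex G B j false) := by
  have h := cubeIndex_succ_eq_facetSum (prismLabel G B) (fun δ => (hG _ _).trans n.le_succ)
  -- The prism has dimension `n + 1`, and label `n + 1` never occurs.
  rw [cubeIndex_eq_zero_of_forall_ne (prismLabel G B) le_rfl
    (fun δ => ne_of_lt (Nat.lt_succ_of_le (hG _ _))), facetSum, Fin.sum_univ_succ] at h
  simp only [Fin.insertNth_zero', Fin.val_zero, pow_zero, one_mul, Fin.val_succ, pow_succ, mul_neg,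
    mul_one, neg_mul, Finset.sum_neg_distrib, prismLabel, Fin.cons_zero, Fin.tail_cons] at h
  exact sub_eq_zero.1 ((sub_eq_add_neg _ _).trans h.symm)

theorem insertNth_apply_of_ne {α : Type*} {p k : Fin (n + 1)} (h : k ≠ p) (a a' : α)
    (ε : Fin n → α) :
    (Fin.insertNth p a ε : Fin (n + 1) → α) k = (Fin.insertNth p a' ε : Fin (n + 1) → α) k := by
  obtain ⟨l, rfl⟩ := Fin.exists_succAbove_eq h
  simp

theorem IsNeighbour.sideIndex_eq {B B' : Box (Fin n)} {j : Fin n} {b : Bool}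
    (h : IsNeighbour B B' j b) (G : Bool → (Fin n → ℝ) → ℕ) :
    sideIndex G B j b = sideIndex G B' j (!b) := by
  unfold sideIndex prismLabel
  congr 1
  ext ε
  rw [insertNth_apply_of_ne (Fin.succ_ne_zero j).symm b (!b)]
  refine congrArg _ (h.vertex_eq (Fin.insertNth_apply_same _ _ _)
    (Fin.insertNth_apply_same _ _ _) fun k hk => ?_)
  exact insertNth_apply_of_ne (by simpa using hk) _ _ _

/-- If the lateral facets on the boundary of `C` have index zero, then top and bottom of the prism
over `C` have the same total index. -/
theorem IsCubicalDecomposition.sum_cubeIndex_eq [Fintype ι] (hD : IsCubicalDecomposition C D)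
    (G : Bool → (Fin n → ℝ) → ℕ) (hG : ∀ b x, G b x ≤ n)
    (hside : ∀ i j b, bound (D i) b j = bound C b j → sideIndex G (D i) j b = 0) :
    ∑ i, cubeIndex n (fun ε => G true (vertex (D i) ε)) =
      ∑ i, cubeIndex n (fun ε => G false (vertex (D i) ε)) := by
  classical
  rw [← sub_eq_zero, ← Finset.sum_sub_distrib]
  simp only [cubeIndex_top_sub_bottom G hG]
  rw [Finset.sum_comm]
  refine Finset.sum_eq_zero fun j _ => ?_
  rw [← Finset.mul_sum, Finset.sum_sub_distrib]
  refine mul_eq_zero_of_right _ (sub_eq_zero.2 ?_)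
  have hfilter : ∀ b, ∑ i, sideIndex G (D i) j b =
      ∑ i with bound (D i) b j ≠ bound C b j, sideIndex G (D i) j b := fun b => by
    refine (Finset.sum_filter_of_ne fun i _ h => ?_).symm
    exact fun h' => h (hside i j b h')
  rw [hfilter, hfilter]
  have hbd : ∀ {i i' b}, IsNeighbour (D i) (D i') j b → bound (D i') (!b) j ≠ bound C (!b) j := by
    intro i i' b h he
    have h₁ := h.bound_eq.symm.trans he
    have h₂ := hD.lower_le_lower i j
    have h₃ := hD.upper_le_upper i j
    have h₄ := (D i).lower_lt_upper j
    cases b <;> simp [bound] at h₁ <;> linarith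
  -- Crossing the upper facet in direction `j` matches cells with an inner upper facet bijectively
  -- to cells with an inner lower one.
  choose! e he using fun i (h : bound (D i) true j ≠ bound C true j) =>
    hD.exists_isNeighbour i j true h
  refine Finset.sum_bij (fun i _ => e i) ?_ ?_ ?_ ?_
  · intro i hi
    simpa using hbd (he i (by simpa using hi))
  · intro i hi i' hi' h
    have h₁ := (he i (by simpa using hi)).symm
    have h₂ := (he i' (by simpa using hi')).symm
    rw [← h] at h₂
    exact hD.isNeighbour_unique h₁ h₂
  · intro i hi
    obtain ⟨i', hi'⟩ := hD.exists_isNeighbour i j false (by simpa using hi)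
    have hne := hbd hi'
    exact ⟨i', by simpa using hne, hD.isNeighbour_unique (he i' hne) hi'.symm⟩
  · intro i hi
    exact (he i (by simpa using hi)).sideIndex_eq G

/-! ### Rounding to the vertices of `C`. -/

/-- Rounding to a vertex of `C`: every coordinate below its upper bound is moved to the lower
bound. -/
noncomputable def roundToVertex (C : Box (Fin n)) (x : Fin n → ℝ) : Fin n → ℝ :=
  fun k => if x k = C.upper k then C.upper k else C.lower k

theorem roundToVertex_apply_of_eq_bound {x : Fin n → ℝ} {j : Fin n} {b : Bool}
    (h : x j = bound C b j) : roundToVertex C x j = bound C b j := by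
  have := (C.lower_lt_upper j).ne
  cases b <;> simp_all [roundToVertex, bound]

theorem roundToVertex_mem_cube (x : Fin n → ℝ) : roundToVertex C x ∈ cube C :=
  mem_cube_iff.2 fun k => by
    have := (C.lower_lt_upper k).le
    unfold roundToVertex
    split_ifs <;> simp [this]

theorem roundToVertex_vertex (C : Box (Fin n)) {B : Box (Fin n)} (hB : B.upper = C.upper)
    (ε : Fin n → Bool) : roundToVertex C (vertex B ε) = vertex C ε := by
  ext k
  have h := (B.lower_lt_upper k).ne
  rw [hB] at h
  cases hk : ε k <;> simp [roundToVertex, vertex, hk, hB, h]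

/-- Only the cell at the upper corner of `C` survives: any other has an upper bound below that of
`C` in some direction, where rounding makes its labels constant. -/
theorem IsCubicalDecomposition.sum_cubeIndex_roundToVertex [Fintype ι]
    (hD : IsCubicalDecomposition C D) (g : (Fin n → ℝ) → ℕ) :
    ∑ i, cubeIndex n (fun ε => g (roundToVertex C (vertex (D i) ε))) =
      cubeIndex n (fun ε => g (vertex C ε)) := by
  obtain ⟨i₀, hi₀⟩ := hD.exists_mem_cube (vertex_mem_cube C fun _ => true)
  have hup : (D i₀).upper = C.upper := funext fun k =>
    le_antisymm (hD.upper_le_upper i₀ k) (mem_cube_iff.1 hi₀ k).2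
  rw [Finset.sum_eq_single i₀]
  · simp only [roundToVertex_vertex C hup]
  · intro i _ hi
    obtain ⟨j, hj⟩ : ∃ j, (D i).upper j ≠ C.upper j := by
      by_contra! h
      refine hi (hD.eq_of_overlap (fun k => ?_) fun k => ?_)
      · rw [hup, ← h k]
        exact (D i).lower_lt_upper k
      · rw [h k, ← hup]
        exact (D i₀).lower_lt_upper k
    refine cubeIndex_eq_zero_of_const _ j fun ε b => congrArg g ?_
    have hlt := (hD.upper_le_upper i j).lt_of_ne hj
    have hlt' := ((D i).lower_lt_upper j).trans hlt
    ext k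
    rcases eq_or_ne k j with rfl | hkj
    · cases b <;> cases hk : ε k <;> simp [roundToVertex, vertex, hk, hlt.ne, hlt'.ne]
    · have : vertex (D i) (Function.update ε j b) k = vertex (D i) ε k := by simp [vertex, hkj]
      simp only [roundToVertex]
      rw [this]
  · simp

/-! ### Additivity of the index and complete labels. -/

/-- Representatives of different labels are different, and their hyperoctants lie in the respective
cones, which meet only at the origin. -/
theorem IsChangeOfLabels.carriesComplete {ψ : VLabel n → Fin (n + 1)} (hψ : IsChangeOfLabels ψ)
    {L : Set (VLabel n)} (hL : ∀ m, ∃ l ∈ L, ψ l = m) : CarriesComplete L := by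
  obtain ⟨N, hN, hsub⟩ := hψ
  choose l hl hlm using hL
  refine ⟨l, fun a b hab => by rw [← hlm a, ← hlm b, hab], hl, ?_⟩
  refine Set.Subset.antisymm ?_ ?_
  · rw [← hN.iInter_eq]
    refine Set.iInter_mono fun m => ?_
    have := hsub (l m)
    rwa [hlm] at this
  · rintro x rfl
    simp [hyperoctant]

/-- The index of `C` is the sum of the indices of the cells. -/
theorem IsCubicalDecomposition.sum_labelIndex_eq [Fintype ι] (hD : IsCubicalDecomposition C D)
    {φ : (Fin n → ℝ) → VLabel n} (hφ : IsNonDegenerate C φ) {ψ : VLabel n → Fin (n + 1)}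
    (hψ : IsChangeOfLabels ψ) : ∑ i, labelIndex ψ φ (D i) = labelIndex ψ φ C := by
  let G : Bool → (Fin n → ℝ) → ℕ := fun b x => ψ (φ (if b then roundToVertex C x else x))
  have h := hD.sum_cubeIndex_eq G (fun b x => Nat.le_of_lt_succ (ψ _).is_lt) fun i j b hb => ?_
  · simp only [G, if_true, Bool.false_eq_true, if_false] at h
    exact h.symm.trans (hD.sum_cubeIndex_roundToVertex fun x => (ψ (φ x) : ℕ))
  · have hface := hφ (Function.update (fun _ => none) j (some b)) ⟨j, by simp⟩
    -- One label is missing on the whole facet of `C`. Rounding keeps points in that facet, so the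
    -- lateral facet misses the label both above and below.
    obtain ⟨m, hm⟩ : ∃ m, ∀ l ∈ φ '' face C (Function.update (fun _ => none) j (some b)),
        ψ l ≠ m := by
      by_contra! hcon
      exact hface (hψ.carriesComplete hcon)
    have hmem : ∀ x ∈ cube C, x j = bound C b j →
        x ∈ face C (Function.update (fun _ => none) j (some b)) := by
      refine fun x hx hxj => ⟨hx, fun k b' hk => ?_⟩
      rcases eq_or_ne k j with rfl | hkj
      · obtain rfl : b = b' := by simpa using hk
        exact hxj
      · simp [hkj] at hk
    refine cubeIndex_eq_zero_of_forall_ne (m := m) _ (Nat.le_of_lt_succ m.is_lt) fun ε he => ?_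
    refine hm _ ⟨_, ?_, rfl⟩ (Fin.ext he)
    set x := vertex (D i) (Fin.tail (Fin.insertNth j.succ b ε : Fin (n + 1) → Bool)) with hx
    have hxC : x ∈ cube C := hD.cube_subset i (vertex_mem_cube _ _)
    have hxj : x j = bound C b j := by
      rw [← hb]
      simp [hx, vertex, bound, Fin.tail]
    split_ifs
    · exact hmem _ (roundToVertex_mem_cube x) (roundToVertex_apply_of_eq_bound hxj)
    · exact hmem _ hxC hxj

theorem isCompletelyLabeled_of_labelIndex_ne_zero {φ : (Fin n → ℝ) → VLabel n}
    {ψ : VLabel n → Fin (n + 1)} (hψ : IsChangeOfLabels ψ) {B : Box (Fin n)}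
    (h : labelIndex ψ φ B ≠ 0) : IsCompletelyLabeled B φ := by
  refine hψ.carriesComplete fun m => ?_
  by_contra! hcon
  exact h (cubeIndex_eq_zero_of_forall_ne (m := m) _ (Nat.le_of_lt_succ m.is_lt)
    fun ε he => hcon _ ⟨ε, rfl⟩ (Fin.ext he))

end CubicalSperner

theorem mainTheorem2 {n : ℕ} {ι : Type*}
    (C : BoxIntegral.Box (Fin n)) (D : ι → BoxIntegral.Box (Fin n))
    (hD : CubicalSperner.IsCubicalDecomposition C D)
    (φ : (Fin n → ℝ) → CubicalSperner.VLabel n)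
    (hφ : CubicalSperner.IsNonDegenerate C φ)
    (ψ : CubicalSperner.VLabel n → Fin (n + 1))
    (hψ : CubicalSperner.IsChangeOfLabels ψ)
    (hind : CubicalSperner.labelIndex ψ φ C ≠ 0) :
    ∃ i, CubicalSperner.labelIndex ψ φ (D i) ≠ 0 ∧
      CubicalSperner.IsCompletelyLabeled (D i) φ := by
  have := hD.finite
  have := Fintype.ofFinite ι
  rw [← hD.sum_labelIndex_eq hφ hψ] at hind
  obtain ⟨i, -, hi⟩ := Finset.exists_ne_zero_of_sum_ne_zero hind
  exact ⟨i, hi, CubicalSperner.isCompletelyLabeled_of_labelIndex_ne_zero hψ hi⟩
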